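/- Let $P$ be a unital subsemigroup (submonoid) of a discrete group $G$, let $V_p\delta_s=\delta_{ps}$ $(p,s\in P)$ be the left creation operators on $\ell^2(P)$, and let $$\mathcal I_V:=\{V_{p_1}^*V_{q_1}\cdots V_{p_n}^*V_{q_n} \mid n\ge 0,\ p_i,q_i\in P\}$$ be the inverse semigroup (with unit) of $V$-words in $\mathrm C^*_\lambda(P)=\mathrm C^*(V_p\mid p\in P)$. Let $\mathrm C^*(\mathcal I_V)$ be its full C*-algebra, i.e. the universal C*-algebra generated by a representation $u$ of $\mathcal I_V$ by partial isometries: $u(ST)=u(S)u(T)$, $u(S^*)=u(S)^*$, $u(I)=1$, and $u(0)=0$ in case the zero operator belongs to $\mathcal I_V$. For $X\subseteq P$ and $p\in P$ write $pX=\{px\mid x\in X\}$ and $p^{-1}X=\{y\in P\mid py\in X\}$, and let $$\mathcal J:=\{p_1^{-1}q_1\cdots p_n^{-1}q_nP\mid n\ge 0,\ p_i,q_i\in P\}\cup\{\emptyset\}$$ be the family of constructible right ideals of $P$. Let $\mathrm C^*_s(P)$ be the universal unital C*-algebra generated by isometries $v_p$ $(p\in P)$ and projections $e_{\mathbf x}$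 $(\mathbf x\in\mathcal J)$ subject to (I) $v_{pq}=v_pv_q$; (II) $e_\emptyset=0$; (III) $v_{p_1}^*v_{q_1}\cdots v_{p_n}^*v_{q_n}=e_{\mathbf x}$ with $\mathbf x=q_n^{-1}p_n\cdots q_1^{-1}p_1P$, whenever $p_1^{-1}q_1\cdots p_n^{-1}q_n=e_G$ in $G$. Then there exists a $*$-isomorphism $$\Phi\colon \mathrm C^*_s(P)\to \mathrm C^*(\mathcal I_V)\quad\text{with}\quad \Phi(v_p)=u(V_p)\ \text{ for all } p\in P,$$ it is the only unital $*$-homomorphism with this property, and it maps $D_s(P):=\mathrm C^*(e_{\mathbf x}\mid \mathbf x\in\mathcal J)$ onto the C*-subalgebra $\mathrm C^*(E)=\mathrm C^*(u(S)\mid S\in E)$ of $\mathrm C^*(\mathcal I_V)$ generated by the semilattice $E$ of idempotents of $\mathcal I_V$. -/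

import Mathlib

noncomputable section

open scoped ComplexConjugate

/-! ## Universal unital C*-algebras given by generators and relations -/

/-- The free unital complex `*`-algebra on a set `X` of generators, realised as the free algebra
on the letters `x` (`Sum.inl x`) and `x*` (`Sum.inr x`). -/
def FreeStarAlg (X : Type*) : Type _ := FreeAlgebra ℂ (X ⊕ X)

namespace FreeStarAlg

variable {X : Type*}

instance : Ring (FreeStarAlg X) := inferInstanceAs (Ring (FreeAlgebra ℂ (X ⊕ X)))
instance : Algebra ℂ (FreeStarAlg X) := inferInstanceAs (Algebra ℂ (FreeAlgebra ℂ (X ⊕ X)))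

/-- The letter `x` or `x*`. -/
def letter (y : X ⊕ X) : FreeStarAlg X := FreeAlgebra.ι ℂ y

/-- The generator `x`. -/
def gen (x : X) : FreeStarAlg X := letter (Sum.inl x)

/-- The universal property of the free algebra on the letters. -/
def liftLetter {B : Type*} [Ring B] [Algebra ℂ B] (f : X ⊕ X → B) : FreeStarAlg X →ₐ[ℂ] B :=
  FreeAlgebra.lift ℂ f

theorem liftLetter_letter {B : Type*} [Ring B] [Algebra ℂ B] (f : X ⊕ X → B) (y : X ⊕ X) :
    liftLetter f (letter y) = f y := FreeAlgebra.lift_ι_apply f y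

theorem induction_on {C : FreeStarAlg X → Prop} (a : FreeStarAlg X)
    (hc : ∀ c : ℂ, C (algebraMap ℂ (FreeStarAlg X) c))
    (hι : ∀ y : X ⊕ X, C (letter y))
    (hm : ∀ a b, C a → C b → C (a * b)) (ha : ∀ a b, C a → C b → C (a + b)) : C a :=
  FreeAlgebra.induction ℂ (X ⊕ X) (motive := C) hc hι hm ha a

/-- The opposite ring of a complex algebra, with scalars acting through complex conjugation. -/
def ConjOp (A : Type*) : Type _ := Aᵐᵒᵖ

instance {A : Type*} [Ring A] : Ring (ConjOp A) := inferInstanceAs (Ring Aᵐᵒᵖ)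
instance {A : Type*} [Ring A] [Algebra ℂ A] : Algebra ℂ (ConjOp A) :=
  ((algebraMap ℂ Aᵐᵒᵖ).comp (starRingEnd ℂ)).toAlgebra'
    (fun c x => Algebra.commutes (A := Aᵐᵒᵖ) (conj c) x)

/-- The ring homomorphism into the opposite ring that exchanges the letters `x` and `x*` and is
conjugate linear. -/
def starHom : FreeStarAlg X →+* (FreeStarAlg X)ᵐᵒᵖ :=
  (liftLetter (B := ConjOp (FreeStarAlg X)) (fun y => MulOpposite.op (letter y.swap))).toRingHom

theorem starHom_letter (y : X ⊕ X) :
    starHom (letter y) = MulOpposite.op (letter y.swap) :=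
  liftLetter_letter (B := ConjOp (FreeStarAlg X)) (fun y => MulOpposite.op (letter y.swap)) y

theorem starHom_algebraMap (c : ℂ) :
    starHom (algebraMap ℂ (FreeStarAlg X) c) =
      MulOpposite.op (algebraMap ℂ (FreeStarAlg X) (conj c)) :=
  AlgHom.commutes
    (liftLetter (B := ConjOp (FreeStarAlg X)) (fun y => MulOpposite.op (letter y.swap))) c

instance : StarRing (FreeStarAlg X) where
  star a := (starHom a).unop
  star_involutive a := by
    refine induction_on (C := fun a => (starHom (starHom a).unop).unop = a) a ?_ ?_ ?_ ?_
    · intro c; simp [starHom_algebraMap]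
    · intro y; rw [starHom_letter, MulOpposite.unop_op, starHom_letter]; simp
    · intro a b ha hb; simp [ha, hb]
    · intro a b ha hb; simp [ha, hb]
  star_mul a b := by simp
  star_add a b := by simp

theorem star_def (a : FreeStarAlg X) : star a = (starHom a).unop := rfl

instance : StarModule ℂ (FreeStarAlg X) where
  star_smul c a := by
    rw [Algebra.smul_def, star_mul, star_def (algebraMap _ _ c), starHom_algebraMap,
      Algebra.smul_def]
    exact (Algebra.commutes _ _).symm

theorem star_gen (x : X) : star (gen x) = letter (Sum.inr x) := by
  rw [star_def, gen, starHom_letter]; rfl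

/-- Evaluation of `*`-polynomials at a family of elements of a unital `*`-algebra. -/
def eval {B : Type*} [Ring B] [StarRing B] [Algebra ℂ B] [StarModule ℂ B] (f : X → B) :
    FreeStarAlg X →⋆ₐ[ℂ] B :=
  { liftLetter (Sum.elim f (fun x => star (f x))) with
    map_star' := by
      intro a
      let L : FreeStarAlg X →ₐ[ℂ] B := liftLetter (Sum.elim f (fun x => star (f x)))
      have hL : ∀ y, L (letter y) =
          Sum.elim f (fun x => star (f x)) y := fun y => liftLetter_letter _ _
      change L (star a) = star (L a)
      refine induction_on (C := fun a => L (star a) = star (L a)) a ?_ ?_ ?_ ?_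
      · intro c
        rw [star_def, starHom_algebraMap, MulOpposite.unop_op, AlgHom.commutes, AlgHom.commutes,
          ← algebraMap_star_comm]; rfl
      · intro y
        rw [star_def, starHom_letter, MulOpposite.unop_op, hL, hL]
        cases y <;> simp
      · intro a b ha hb
        rw [star_mul, map_mul, map_mul, star_mul, ha, hb]
      · intro a b ha hb
        rw [star_add, map_add, map_add, star_add, ha, hb] }

theorem eval_gen {B : Type*} [Ring B] [StarRing B] [Algebra ℂ B] [StarModule ℂ B] (f : X → B)
    (x : X) : eval f (gen x) = f x :=
  liftLetter_letter (Sum.elim f (fun x => star (f x))) (Sum.inl x)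

theorem hom_ext {B : Type*} [Ring B] [StarRing B] [Algebra ℂ B] [StarModule ℂ B]
    {φ ψ : FreeStarAlg X →⋆ₐ[ℂ] B} (h : ∀ x, φ (gen x) = ψ (gen x)) : φ = ψ := by
  ext a
  refine induction_on (C := fun a => φ a = ψ a) a ?_ ?_ ?_ ?_
  · intro c; exact (AlgHomClass.commutes φ c).trans (AlgHomClass.commutes ψ c).symm
  · rintro (x | x)
    · exact h x
    · rw [← star_gen, map_star, map_star, h]
  · intro a b ha hb; rw [map_mul, map_mul, ha, hb]
  · intro a b ha hb; rw [map_add, map_add, ha, hb]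

end FreeStarAlg

/-- A C*-seminorm on a unital complex `*`-algebra. -/
structure CStarSeminorm (A : Type*) [Ring A] [StarRing A] [Algebra ℂ A] extends
    Seminorm ℂ A where
  mul_le' : ∀ a b, toFun (a * b) ≤ toFun a * toFun b
  star_mul_self' : ∀ a, toFun (star a * a) = toFun a ^ 2

namespace CStarSeminorm

variable {A : Type*} [Ring A] [StarRing A] [Algebra ℂ A]

instance : CoeFun (CStarSeminorm A) (fun _ => A → ℝ) := ⟨fun p => p.toSeminorm⟩

theorem mul_le (p : CStarSeminorm A) (a b : A) : p (a * b) ≤ p a * p b := p.mul_le' a b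
theorem star_mul_self (p : CStarSeminorm A) (a : A) : p (star a * a) = p a ^ 2 :=
  p.star_mul_self' a
theorem add_le (p : CStarSeminorm A) (a b : A) : p (a + b) ≤ p a + p b :=
  map_add_le_add p.toSeminorm a b
theorem smul_eq (p : CStarSeminorm A) (c : ℂ) (a : A) : p (c • a) = ‖c‖ * p a :=
  map_smul_eq_mul p.toSeminorm c a
theorem nonneg (p : CStarSeminorm A) (a : A) : 0 ≤ p a := apply_nonneg p.toSeminorm a
theorem map_zero (p : CStarSeminorm A) : p 0 = 0 := _root_.map_zero p.toSeminorm

theorem le_star (p : CStarSeminorm A) (a : A) : p a ≤ p (star a) := by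
  by_contra! h
  have h1 := p.star_mul_self a
  have h2 := p.mul_le (star a) a
  have h3 := p.nonneg (star a)
  nlinarith

theorem map_star (p : CStarSeminorm A) (a : A) : p (star a) = p a :=
  le_antisymm (by simpa using p.le_star (star a)) (p.le_star a)

theorem eq_of_sub (p : CStarSeminorm A) {a b : A} (h : p (a - b) = 0) : p a = p b := by
  have h1 := abs_sub_map_le_sub p.toSeminorm a b
  rw [h] at h1
  have := abs_nonpos_iff.1 h1
  linarith

theorem le_one_of_sq (p : CStarSeminorm A) {a : A} (h : p a ^ 2 = p a) : p a ≤ 1 := by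
  nlinarith [p.nonneg a]

theorem map_one_le (p : CStarSeminorm A) : p 1 ≤ 1 := by
  apply p.le_one_of_sq
  simpa using (p.star_mul_self 1).symm

/-- The zero seminorm. -/
def zero : CStarSeminorm A where
  toSeminorm := 0
  mul_le' a b := by change (0 : ℝ) ≤ 0 * 0; simp
  star_mul_self' a := by change (0 : ℝ) = 0 ^ 2; simp

end CStarSeminorm

/-- Generators `X` and relations `rel a b` (read `a = b`) between `*`-polynomials, such that the
relations bound the norms of the generators. -/
structure CStarPresentation (X : Type*) where
  rel : FreeStarAlg X → FreeStarAlg X → Prop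
  bounded : ∀ x : X, ∃ C : ℝ, ∀ p : CStarSeminorm (FreeStarAlg X),
    (∀ a b, rel a b → p (a - b) = 0) → p (FreeStarAlg.gen x) ≤ C

namespace CStarPresentation

open FreeStarAlg

variable {X : Type*} (𝓟 : CStarPresentation X)

/-- The C*-seminorms on the free `*`-algebra that are compatible with the relations. -/
def Admissible : Type _ :=
  {p : CStarSeminorm (FreeStarAlg X) // ∀ a b, 𝓟.rel a b → p (a - b) = 0}

instance : Nonempty 𝓟.Admissible := ⟨⟨CStarSeminorm.zero, fun _ _ _ => rfl⟩⟩

theorem bddAbove (a : FreeStarAlg X) :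
    BddAbove (Set.range fun p : 𝓟.Admissible => p.1 a) := by
  suffices h : ∃ C : ℝ, ∀ p : 𝓟.Admissible, p.1 a ≤ C by
    obtain ⟨C, hC⟩ := h
    exact ⟨C, by rintro _ ⟨p, rfl⟩; exact hC p⟩
  refine induction_on (C := fun a => ∃ C : ℝ, ∀ p : 𝓟.Admissible, p.1 a ≤ C) a ?_ ?_ ?_ ?_
  · intro c
    refine ⟨‖c‖, fun p => ?_⟩
    rw [Algebra.algebraMap_eq_smul_one, p.1.smul_eq]
    exact mul_le_of_le_one_right (norm_nonneg _) p.1.map_one_le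
  · rintro (x | x)
    · obtain ⟨C, hC⟩ := 𝓟.bounded x
      exact ⟨C, fun p => hC p.1 p.2⟩
    · obtain ⟨C, hC⟩ := 𝓟.bounded x
      refine ⟨C, fun p => ?_⟩
      rw [← star_gen, p.1.map_star]
      exact hC p.1 p.2
  · rintro a b ⟨C, hC⟩ ⟨D, hD⟩
    exact ⟨C * D, fun p => (p.1.mul_le a b).trans
      (mul_le_mul (hC p) (hD p) (p.1.nonneg b) ((p.1.nonneg a).trans (hC p)))⟩
  · rintro a b ⟨C, hC⟩ ⟨D, hD⟩
    exact ⟨C + D, fun p => (p.1.add_le a b).trans (add_le_add (hC p) (hD p))⟩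

/-- The value at `a` of the largest C*-seminorm compatible with the relations. -/
def maxNorm (a : FreeStarAlg X) : ℝ := ⨆ p : 𝓟.Admissible, p.1 a

theorem le_maxNorm (p : 𝓟.Admissible) (a : FreeStarAlg X) : p.1 a ≤ 𝓟.maxNorm a :=
  le_ciSup (𝓟.bddAbove a) p

theorem maxNorm_le {a : FreeStarAlg X} {C : ℝ} (h : ∀ p : 𝓟.Admissible, p.1 a ≤ C) :
    𝓟.maxNorm a ≤ C := ciSup_le h

theorem maxNorm_nonneg (a : FreeStarAlg X) : 0 ≤ 𝓟.maxNorm a :=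
  (Classical.arbitrary 𝓟.Admissible).1.nonneg a |>.trans (𝓟.le_maxNorm _ a)

/-- The largest C*-seminorm on the free `*`-algebra compatible with the relations. -/
def maxSeminorm : CStarSeminorm (FreeStarAlg X) where
  toSeminorm := Seminorm.ofSMulLE 𝓟.maxNorm
    (le_antisymm (𝓟.maxNorm_le fun p => p.1.map_zero.le) (𝓟.maxNorm_nonneg 0))
    (fun a b => 𝓟.maxNorm_le fun p => (p.1.add_le a b).trans
      (add_le_add (𝓟.le_maxNorm p a) (𝓟.le_maxNorm p b)))
    (fun c a => 𝓟.maxNorm_le fun p => by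
      rw [p.1.smul_eq]; exact mul_le_mul_of_nonneg_left (𝓟.le_maxNorm p a) (norm_nonneg _))
  mul_le' a b := 𝓟.maxNorm_le fun p => (p.1.mul_le a b).trans
    (mul_le_mul (𝓟.le_maxNorm p a) (𝓟.le_maxNorm p b) (p.1.nonneg b) (𝓟.maxNorm_nonneg a))
  star_mul_self' a := by
    change 𝓟.maxNorm (star a * a) = 𝓟.maxNorm a ^ 2
    refine le_antisymm (𝓟.maxNorm_le fun p => ?_) ?_
    · rw [p.1.star_mul_self]
      exact pow_le_pow_left₀ (p.1.nonneg a) (𝓟.le_maxNorm p a) 2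
    · refine (Real.le_sqrt (𝓟.maxNorm_nonneg a) (𝓟.maxNorm_nonneg _)).1 ?_
      refine 𝓟.maxNorm_le fun p => Real.le_sqrt_of_sq_le ?_
      rw [← p.1.star_mul_self]
      exact 𝓟.le_maxNorm p _

theorem maxSeminorm_apply (a : FreeStarAlg X) : 𝓟.maxSeminorm a = 𝓟.maxNorm a := rfl

theorem maxSeminorm_rel {a b : FreeStarAlg X} (h : 𝓟.rel a b) : 𝓟.maxSeminorm (a - b) = 0 :=
  le_antisymm (𝓟.maxNorm_le fun p => (p.2 a b h).le) (𝓟.maxNorm_nonneg _)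

/-- The free `*`-algebra, equipped with the largest C*-seminorm compatible with the relations. -/
def Pre (_ : CStarPresentation X) : Type _ := FreeStarAlg X

instance : Ring 𝓟.Pre := inferInstanceAs (Ring (FreeStarAlg X))
instance : StarRing 𝓟.Pre := inferInstanceAs (StarRing (FreeStarAlg X))
instance : Algebra ℂ 𝓟.Pre := inferInstanceAs (Algebra ℂ (FreeStarAlg X))
instance : StarModule ℂ 𝓟.Pre := inferInstanceAs (StarModule ℂ (FreeStarAlg X))

instance : SeminormedRing 𝓟.Pre where
  __ : Ring 𝓟.Pre := inferInstance
  __ : SeminormedAddCommGroup 𝓟.Pre :=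
    AddGroupSeminorm.toSeminormedAddCommGroup (E := 𝓟.Pre) 𝓟.maxSeminorm.toAddGroupSeminorm
  norm_mul_le a b := 𝓟.maxSeminorm.mul_le a b

theorem norm_pre (a : 𝓟.Pre) : ‖a‖ = 𝓟.maxSeminorm a := rfl

instance : NormedAlgebra ℂ 𝓟.Pre where
  norm_smul_le c a := (𝓟.maxSeminorm.smul_eq c a).le

theorem norm_star_pre (a : 𝓟.Pre) : ‖star a‖ = ‖a‖ := 𝓟.maxSeminorm.map_star a

theorem norm_star_mul_self_pre (a : 𝓟.Pre) : ‖star a * a‖ = ‖a‖ * ‖a‖ := by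
  rw [← sq]; exact 𝓟.maxSeminorm.star_mul_self a

theorem uniformContinuous_star_pre : UniformContinuous (star : 𝓟.Pre → 𝓟.Pre) :=
  (AddMonoidHomClass.isometry_of_norm (starAddEquiv : 𝓟.Pre ≃+ 𝓟.Pre)
    𝓟.norm_star_pre).uniformContinuous

/-- The universal unital C*-algebra with the given generators and relations: the Hausdorff
completion of the free `*`-algebra for the largest C*-seminorm compatible with the relations. -/
def Alg : Type _ := UniformSpace.Completion 𝓟.Pre

instance : NormedRing 𝓟.Alg := inferInstanceAs (NormedRing (UniformSpace.Completion 𝓟.Pre))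
instance : CompleteSpace 𝓟.Alg := inferInstanceAs (CompleteSpace (UniformSpace.Completion 𝓟.Pre))
instance : Algebra ℂ 𝓟.Alg := inferInstanceAs (Algebra ℂ (UniformSpace.Completion 𝓟.Pre))
instance : NormedSpace ℂ 𝓟.Alg := inferInstanceAs (NormedSpace ℂ (UniformSpace.Completion 𝓟.Pre))
instance : NormedAlgebra ℂ 𝓟.Alg where
  norm_smul_le := fun c a => norm_smul_le (α := ℂ) (β := UniformSpace.Completion 𝓟.Pre) c a

/-- The canonical map from `*`-polynomials to the universal C*-algebra. -/
def poly (a : FreeStarAlg X) : 𝓟.Alg := UniformSpace.Completion.coe' (α := 𝓟.Pre) a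

theorem poly_add (a b : FreeStarAlg X) : 𝓟.poly (a + b) = 𝓟.poly a + 𝓟.poly b :=
  UniformSpace.Completion.coe_add (α := 𝓟.Pre) a b
theorem poly_mul (a b : FreeStarAlg X) : 𝓟.poly (a * b) = 𝓟.poly a * 𝓟.poly b :=
  UniformSpace.Completion.coe_mul (α := 𝓟.Pre) a b
theorem poly_smul (c : ℂ) (a : FreeStarAlg X) : 𝓟.poly (c • a) = c • 𝓟.poly a :=
  UniformSpace.Completion.coe_smul (X := 𝓟.Pre) c a
theorem norm_poly (a : FreeStarAlg X) : ‖𝓟.poly a‖ = 𝓟.maxSeminorm a :=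
  UniformSpace.Completion.norm_coe (E := 𝓟.Pre) a
theorem denseRange_poly : DenseRange 𝓟.poly :=
  UniformSpace.Completion.denseRange_coe (α := 𝓟.Pre)

instance : Star 𝓟.Alg where
  star := UniformSpace.Completion.map (star : 𝓟.Pre → 𝓟.Pre)

theorem star_poly (a : FreeStarAlg X) : star (𝓟.poly a) = 𝓟.poly (star a) :=
  UniformSpace.Completion.map_coe 𝓟.uniformContinuous_star_pre a

theorem continuous_star_alg : Continuous (star : 𝓟.Alg → 𝓟.Alg) :=
  UniformSpace.Completion.continuous_map

theorem alg_ext {Y : Type*} [TopologicalSpace Y] [T2Space Y] {f g : 𝓟.Alg → Y}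
    (hf : Continuous f) (hg : Continuous g) (h : ∀ a, f (𝓟.poly a) = g (𝓟.poly a))
    (a : 𝓟.Alg) : f a = g a :=
  congrFun (𝓟.denseRange_poly.equalizer hf hg (funext h)) a

theorem alg_ext₂ {Y : Type*} [TopologicalSpace Y] [T2Space Y] {f g : 𝓟.Alg × 𝓟.Alg → Y}
    (hf : Continuous f) (hg : Continuous g)
    (h : ∀ a b, f (𝓟.poly a, 𝓟.poly b) = g (𝓟.poly a, 𝓟.poly b)) (a b : 𝓟.Alg) :
    f (a, b) = g (a, b) :=
  congrFun ((𝓟.denseRange_poly.prodMap 𝓟.denseRange_poly).equalizer hf hg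
    (funext fun x => h x.1 x.2)) (a, b)

instance : StarRing 𝓟.Alg where
  star_involutive := by
    have hs := 𝓟.continuous_star_alg
    refine 𝓟.alg_ext (hs.comp hs) continuous_id fun a => ?_
    simp [star_poly]
  star_mul := by
    have hs := 𝓟.continuous_star_alg
    refine 𝓟.alg_ext₂ (hs.comp (continuous_fst.mul continuous_snd))
      ((hs.comp continuous_snd).mul (hs.comp continuous_fst)) fun a b => ?_
    change star (𝓟.poly a * 𝓟.poly b) = star (𝓟.poly b) * star (𝓟.poly a)
    rw [← poly_mul, star_poly, star_poly, star_poly, star_mul, poly_mul]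
  star_add := by
    have hs := 𝓟.continuous_star_alg
    refine 𝓟.alg_ext₂ (hs.comp (continuous_fst.add continuous_snd))
      ((hs.comp continuous_fst).add (hs.comp continuous_snd)) fun a b => ?_
    change star (𝓟.poly a + 𝓟.poly b) = star (𝓟.poly a) + star (𝓟.poly b)
    rw [← poly_add, star_poly, star_poly, star_poly, star_add, poly_add]

instance : CStarAlgebra 𝓟.Alg where
  star_smul c := by
    have hs := 𝓟.continuous_star_alg
    refine 𝓟.alg_ext (hs.comp (continuous_const_smul c)) (hs.const_smul (star c)) fun a => ?_
    change star (c • 𝓟.poly a) = star c • star (𝓟.poly a)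
    rw [← poly_smul, star_poly, star_poly, star_smul, poly_smul]
  norm_mul_self_le a := by
    have hs := 𝓟.continuous_star_alg
    refine le_of_eq (𝓟.alg_ext (continuous_norm.mul continuous_norm)
      (continuous_norm.comp (hs.mul continuous_id)) (fun a => ?_) a)
    change ‖𝓟.poly a‖ * ‖𝓟.poly a‖ = ‖star (𝓟.poly a) * 𝓟.poly a‖
    rw [star_poly, ← poly_mul, norm_poly, norm_poly, CStarSeminorm.star_mul_self, sq]

/-- The image of a generator in the universal C*-algebra. -/
def of (x : X) : 𝓟.Alg := 𝓟.poly (gen x)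

/-- The canonical map as a `*`-homomorphism. -/
def polyHom : FreeStarAlg X →⋆ₐ[ℂ] 𝓟.Alg where
  toFun := 𝓟.poly
  map_one' := rfl
  map_zero' := rfl
  map_mul' := 𝓟.poly_mul
  map_add' := 𝓟.poly_add
  commutes' c := by
    rw [Algebra.algebraMap_eq_smul_one, poly_smul, Algebra.algebraMap_eq_smul_one]; rfl
  map_star' a := (𝓟.star_poly a).symm

theorem polyHom_apply (a : FreeStarAlg X) : 𝓟.polyHom a = 𝓟.poly a := rfl

theorem polyHom_eq_eval : 𝓟.polyHom = eval 𝓟.of :=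
  hom_ext fun x => by rw [eval_gen]; rfl

/-- The generators of the universal C*-algebra satisfy the relations. -/
theorem eval_of_rel {a b : FreeStarAlg X} (h : 𝓟.rel a b) : eval 𝓟.of a = eval 𝓟.of b := by
  rw [← polyHom_eq_eval, ← sub_eq_zero, ← map_sub, ← norm_eq_zero, polyHom_apply, norm_poly]
  exact 𝓟.maxSeminorm_rel h

/-- The universal property: every family satisfying the relations in a unital C*-algebra (in any
universe) is the image of the generators under a unique unital `*`-homomorphism. -/
theorem existsUnique_lift {B : Type*} [CStarAlgebra B] (f : X → B)
    (hf : ∀ a b, 𝓟.rel a b → eval f a = eval f b) :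
    ∃! φ : 𝓟.Alg →⋆ₐ[ℂ] B, ∀ x, φ (𝓟.of x) = f x := by
  have hcont : ∀ φ : 𝓟.Alg →⋆ₐ[ℂ] B, Continuous φ := fun φ =>
    AddMonoidHomClass.continuous_of_bound φ 1 fun a => by
      rw [one_mul]; exact NonUnitalStarAlgHom.norm_apply_le φ a
  let q : CStarSeminorm (FreeStarAlg X) :=
    { toSeminorm := (normSeminorm ℂ B).comp (eval f).toAlgHom.toLinearMap
      mul_le' := fun a b => by
        change ‖eval f (a * b)‖ ≤ ‖eval f a‖ * ‖eval f b‖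
        rw [map_mul]; exact norm_mul_le _ _
      star_mul_self' := fun a => by
        change ‖eval f (star a * a)‖ = ‖eval f a‖ ^ 2
        rw [map_mul, map_star, CStarRing.norm_star_mul_self, sq] }
  have hq : ∀ a, q a = ‖eval f a‖ := fun a => rfl
  have hle : ∀ a, ‖eval f a‖ ≤ 𝓟.maxSeminorm a := fun a =>
    𝓟.le_maxNorm ⟨q, fun a b h => by rw [hq, map_sub, hf a b h, sub_self, norm_zero]⟩ a
  let g : 𝓟.Pre →+* B := (eval f).toAlgHom.toRingHom
  have hg : ∀ a : FreeStarAlg X, g a = eval f a := fun _ => rfl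
  have hgc : Continuous g := AddMonoidHomClass.continuous_of_bound g 1 fun a => by
    rw [one_mul]; exact hle a
  let Φ : 𝓟.Alg →+* B := UniformSpace.Completion.extensionHom g hgc
  have hΦ : ∀ a, Φ (𝓟.poly a) = eval f a := fun a =>
    UniformSpace.Completion.extensionHom_coe g hgc a
  have hΦc : Continuous Φ := UniformSpace.Completion.continuous_extension
  refine ⟨{ Φ with
    commutes' := fun c => ?_
    map_star' := fun a => ?_ }, fun x => ?_, fun ψ hψ => ?_⟩
  · change Φ _ = _
    have : algebraMap ℂ 𝓟.Alg c = 𝓟.poly (algebraMap ℂ _ c) :=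
      (AlgHomClass.commutes 𝓟.polyHom c).symm
    rw [this, hΦ]
    exact AlgHomClass.commutes (eval f) c
  · change Φ (star a) = star (Φ a)
    refine 𝓟.alg_ext (hΦc.comp 𝓟.continuous_star_alg) (continuous_star.comp hΦc)
      (fun a => ?_) a
    change Φ (star (𝓟.poly a)) = star (Φ (𝓟.poly a))
    rw [star_poly, hΦ, hΦ, map_star]
  · change Φ (𝓟.poly _) = _
    rw [hΦ, eval_gen]
  · have key : ∀ a, ψ (𝓟.poly a) = Φ (𝓟.poly a) := fun a => by
      rw [hΦ]
      have : ψ.comp 𝓟.polyHom = eval f := hom_ext fun x => by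
        rw [eval_gen, ← hψ x]; rfl
      exact DFunLike.congr_fun this a
    ext a
    exact 𝓟.alg_ext (hcont ψ) hΦc key a

end CStarPresentation

/-! ## The left regular representation, V-words and constructible ideals -/

section Semigroup

variable {G : Type*} [Group G] (P : Submonoid G)

/-- The Hilbert space `ℓ²(P)`. -/
abbrev ell2 : Type _ := lp (fun _ : P => ℂ) 2

open scoped Classical in
/-- The standard basis vector `δ_s` of `ℓ²(P)`. -/
def delta (s : P) : ell2 P := lp.single 2 s (1 : ℂ)

theorem delta_apply_self (s : P) : delta P s s = 1 := by simp [delta]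

theorem delta_apply_ne {s t : P} (h : t ≠ s) : delta P s t = 0 := by simp [delta, h]

theorem inner_delta (s : P) (f : ell2 P) : inner ℂ (delta P s) f = f s := by
  classical
  simp [delta, lp.inner_single_left]

theorem orthonormal_delta : Orthonormal ℂ (delta P) := by
  classical
  rw [orthonormal_iff_ite]
  intro s t
  rw [inner_delta]
  split_ifs with h
  · rw [h, delta_apply_self]
  · exact delta_apply_ne P h

theorem orthonormal_delta_mul (p : P) : Orthonormal ℂ (fun s : P => delta P (p * s)) :=
  (orthonormal_delta P).comp _ (mul_right_injective p)

/-- The left creation operator `V_p` on `ℓ²(P)`, determined by `V_p δ_s = δ_{ps}`. -/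
def leftCreation (p : P) : ell2 P →L[ℂ] ell2 P :=
  ((orthonormal_delta_mul P p).orthogonalFamily.linearIsometry).toContinuousLinearMap

theorem leftCreation_delta (p s : P) : leftCreation P p (delta P s) = delta P (p * s) := by
  classical
  have h := (orthonormal_delta_mul P p).orthogonalFamily.linearIsometry_apply_single (i := s)
    (1 : ℂ)
  simp only [LinearIsometry.toSpanSingleton_apply, one_smul] at h
  rw [← h]
  simp only [leftCreation, delta]
  rfl

theorem ext_delta {A B : ell2 P →L[ℂ] ell2 P} (h : ∀ s, A (delta P s) = B (delta P s)) :
    A = B := by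
  classical
  refine lp.ext_continuousLinearMap (by norm_num) fun s => ContinuousLinearMap.ext_ring ?_
  exact h s

theorem leftCreation_one : leftCreation P 1 = 1 :=
  ext_delta P fun s => by rw [leftCreation_delta, one_mul]; rfl

/-- For a word `(p₁, q₁), …, (pₙ, qₙ)`, the product `a_{p₁}* a_{q₁} ⋯ a_{pₙ}* a_{qₙ}` in a
`*`-algebra, for a family `a` indexed by `P`. -/
def starWord {P A : Type*} [Monoid A] [Star A] (a : P → A) (w : List (P × P)) : A :=
  (w.map fun x => star (a x.1) * a x.2).prod

/-- For a word `(p₁, q₁), …, (pₙ, qₙ)`, the element `p₁⁻¹ q₁ ⋯ pₙ⁻¹ qₙ` of the group. -/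
def groupWord (w : List (P × P)) : G := (w.map fun x => (x.1 : G)⁻¹ * (x.2 : G)).prod

/-- For a word `(p₁, q₁), …, (pₙ, qₙ)`, the right ideal `p₁⁻¹ q₁ ⋯ pₙ⁻¹ qₙ P` of `P`, where
`q X` is the image and `p⁻¹ X = {y ∈ P | p y ∈ X}` the preimage under left multiplication
in `P`. -/
def idealWord (w : List (P × P)) : Set P :=
  w.foldr (fun x X => (fun y => x.1 * y) ⁻¹' ((fun y => x.2 * y) '' X)) Set.univ

/-- The word `(qₙ, pₙ), …, (q₁, p₁)`. -/
def dualWord {P : Type*} (w : List (P × P)) : List (P × P) := (w.map Prod.swap).reverse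

/-- The family `𝒥` of constructible right ideals of `P`. -/
def constructibleIdeals : Set (Set P) := insert ∅ (Set.range (idealWord P))

theorem empty_mem : (∅ : Set P) ∈ constructibleIdeals P := Set.mem_insert _ _

theorem idealWord_mem (w : List (P × P)) : idealWord P w ∈ constructibleIdeals P :=
  Set.mem_insert_of_mem _ ⟨w, rfl⟩

/-! ## The constructible semigroup C*-algebra -/

/-- Generators of the constructible semigroup C*-algebra: `v_p` for `p ∈ P` and `e_x` for
constructible right ideals `x`. -/
abbrev ConstrGen : Type _ := P ⊕ constructibleIdeals P

/-- The generator `v_p` in the free `*`-algebra. -/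
def genV (p : P) : FreeStarAlg (ConstrGen P) := FreeStarAlg.gen (Sum.inl p)

/-- The generator `e_x` in the free `*`-algebra. -/
def genE (x : constructibleIdeals P) : FreeStarAlg (ConstrGen P) := FreeStarAlg.gen (Sum.inr x)

/-- The defining relations of the constructible semigroup C*-algebra. -/
inductive ConstrRel : FreeStarAlg (ConstrGen P) → FreeStarAlg (ConstrGen P) → Prop
  | isometry (p : P) : ConstrRel (star (genV P p) * genV P p) 1
  | selfAdjoint (x : constructibleIdeals P) : ConstrRel (star (genE P x)) (genE P x)
  | idempotent (x : constructibleIdeals P) : ConstrRel (genE P x * genE P x) (genE P x)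
  | mul (p q : P) : ConstrRel (genV P (p * q)) (genV P p * genV P q)
  | empty : ConstrRel (genE P ⟨∅, empty_mem P⟩) 0
  | word (w : List (P × P)) (hw : groupWord P w = 1) :
      ConstrRel (starWord (genV P) w) (genE P ⟨idealWord P (dualWord w), idealWord_mem P _⟩)

/-- The presentation of the constructible semigroup C*-algebra. -/
def constrPresentation : CStarPresentation (ConstrGen P) where
  rel := ConstrRel P
  bounded := by
    rintro (p | x)
    · refine ⟨1, fun n hn => ?_⟩
      have h1 := n.eq_of_sub (hn _ _ (ConstrRel.isometry p))
      rw [n.star_mul_self] at h1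
      have h2 := n.map_one_le
      have h3 := n.nonneg (genV P p)
      change n (genV P p) ≤ 1
      nlinarith
    · refine ⟨1, fun n hn => ?_⟩
      have h1 := hn _ _ (ConstrRel.selfAdjoint x)
      have h2 := n.eq_of_sub (hn _ _ (ConstrRel.idempotent x))
      have h3 : n (star (genE P x) * genE P x) = n (genE P x * genE P x) := by
        apply n.eq_of_sub
        rw [← sub_mul]
        refine le_antisymm ((n.mul_le _ _).trans ?_) (n.nonneg _)
        rw [h1, zero_mul]
      rw [n.star_mul_self, h2] at h3
      exact n.le_one_of_sq h3

/-- The constructible semigroup C*-algebra `C*_s(P)`. -/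
abbrev CStarS : Type _ := (constrPresentation P).Alg

/-- The canonical isometry `v_p` in `C*_s(P)`. -/
def isoS (p : P) : CStarS P := (constrPresentation P).of (Sum.inl p)

/-- The canonical projection `e_x` in `C*_s(P)`. -/
def projS (x : constructibleIdeals P) : CStarS P := (constrPresentation P).of (Sum.inr x)

/-- The diagonal `D_s(P)`: the C*-subalgebra of `C*_s(P)` generated by the projections `e_x`. -/
def diagS : StarSubalgebra ℂ (CStarS P) :=
  (StarAlgebra.adjoin ℂ (Set.range (projS P))).topologicalClosure

/-! ## The inverse semigroup of V-words and its full C*-algebra -/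

theorem starWord_append {P A : Type*} [Monoid A] [Star A] (a : P → A) (w w' : List (P × P)) :
    starWord a (w ++ w') = starWord a w * starWord a w' := by
  simp [starWord]

theorem star_starWord {P A : Type*} [Monoid A] [StarMul A] (a : P → A) (w : List (P × P)) :
    star (starWord a w) = starWord a (dualWord w) := by
  induction w with
  | nil => simp [starWord, dualWord]
  | cons x w ih =>
    have h : dualWord (x :: w) = dualWord w ++ [x.swap] := by simp [dualWord]
    rw [h, starWord_append, ← ih]
    simp [starWord]

/-- The inverse semigroup `I_V` of V-words `V_{p₁}* V_{q₁} ⋯ V_{pₙ}* V_{qₙ}`. -/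
def VWords : Submonoid (ell2 P →L[ℂ] ell2 P) where
  carrier := Set.range (starWord (leftCreation P))
  one_mem' := ⟨[], rfl⟩
  mul_mem' := by
    rintro _ _ ⟨w, rfl⟩ ⟨w', rfl⟩
    exact ⟨w ++ w', starWord_append _ _ _⟩

instance : StarMul (VWords P) where
  star s := ⟨star (s : ell2 P →L[ℂ] ell2 P), by
    obtain ⟨_, w, rfl⟩ := s
    exact ⟨dualWord w, (star_starWord _ _).symm⟩⟩
  star_involutive s := Subtype.ext (star_star _)
  star_mul s t := Subtype.ext (star_mul _ _)

theorem VWords.coe_star (s : VWords P) :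
    ((star s : VWords P) : ell2 P →L[ℂ] ell2 P) = star (s : ell2 P →L[ℂ] ell2 P) := rfl

theorem delta_ne_zero (t : P) : delta P t ≠ 0 := (orthonormal_delta P).ne_zero t

theorem delta_injective : Function.Injective (delta P) :=
  (orthonormal_delta P).linearIndependent.injective

theorem leftCreation_star_delta (p t : P) :
    star (leftCreation P p) (delta P t) = 0 ∨
      ∃ s : P, p * s = t ∧ star (leftCreation P p) (delta P t) = delta P s := by
  have key : ∀ r : P, star (leftCreation P p) (delta P t) r = delta P t (p * r) := by
    intro r
    rw [← inner_delta, ContinuousLinearMap.star_eq_adjoint,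
      ContinuousLinearMap.adjoint_inner_right, leftCreation_delta, inner_delta]
  by_cases h : ∃ s, p * s = t
  · obtain ⟨s, rfl⟩ := h
    refine Or.inr ⟨s, rfl, ?_⟩
    ext r
    rw [key]
    by_cases hr : r = s
    · rw [hr, delta_apply_self, delta_apply_self]
    · rw [delta_apply_ne P hr, delta_apply_ne P (fun h => hr (mul_left_cancel h))]
  · left
    ext r
    rw [key, delta_apply_ne P (fun h' => h ⟨r, h'⟩)]
    rfl

/-- A V-word acts on the standard basis as a partial translation. -/
theorem VWords.exists_translation (s : VWords P) : ∃ g : G, ∀ t : P,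
    (s : ell2 P →L[ℂ] ell2 P) (delta P t) = 0 ∨
      ∃ t' : P, (t' : G) = g * t ∧ (s : ell2 P →L[ℂ] ell2 P) (delta P t) = delta P t' := by
  obtain ⟨_, w, rfl⟩ := s
  refine ⟨groupWord P w, fun t => ?_⟩
  induction w with
  | nil => exact Or.inr ⟨t, by simp [groupWord], by simp [starWord]⟩
  | cons x w ih =>
    have h1 : ∀ f, starWord (leftCreation P) (x :: w) f =
      star (leftCreation P x.1) (leftCreation P x.2 (starWord (leftCreation P) w f)) := by
      intro f; simp [starWord]
    have h2 : groupWord P (x :: w) = (x.1 : G)⁻¹ * x.2 * groupWord P w := by simp [groupWord]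
    simp only [h1, h2]
    rcases ih with h | ⟨t', ht', h⟩
    · left; simp only at h; rw [h, map_zero, map_zero]
    · simp only at h
      rw [h, leftCreation_delta]
      rcases leftCreation_star_delta P x.1 (x.2 * t') with h | ⟨r, hr, h⟩
      · exact Or.inl h
      · refine Or.inr ⟨r, ?_, h⟩
        have := congrArg (Subtype.val : P → G) hr
        simp only [Submonoid.coe_mul] at this
        rw [mul_assoc, mul_assoc, ← ht', ← this, inv_mul_cancel_left]

/-- V-words are partial isometries. -/
theorem VWords.mul_star_mul_self (s : VWords P) : s * star s * s = s := by
  refine Subtype.ext (ext_delta P fun t => ?_)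
  obtain ⟨g, hg⟩ := VWords.exists_translation P s
  obtain ⟨k, hk⟩ := VWords.exists_translation P (star s)
  simp only [Submonoid.coe_mul, VWords.coe_star, mul_apply_eq_comp] at hk ⊢
  rcases hg t with h | ⟨t', -, h⟩
  · rw [h, map_zero, map_zero]
  · rw [h]
    have h0 : inner ℂ (delta P t) (star (s : ell2 P →L[ℂ] ell2 P) (delta P t')) = 1 := by
      rw [ContinuousLinearMap.star_eq_adjoint, ContinuousLinearMap.adjoint_inner_right, h,
        inner_delta, delta_apply_self]
    rcases hk t' with h' | ⟨t'', -, h'⟩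
    · rw [h', inner_zero_right] at h0
      exact absurd h0 zero_ne_one
    · rw [h', inner_delta] at h0
      have : t = t'' := by
        by_contra hne
        rw [delta_apply_ne P hne] at h0
        exact zero_ne_one h0
      rw [h', ← this, h]

theorem VWords.idempotent_delta {e : VWords P} (he : IsIdempotentElem e) (t : P) :
    (e : ell2 P →L[ℂ] ell2 P) (delta P t) = 0 ∨
      (e : ell2 P →L[ℂ] ell2 P) (delta P t) = delta P t := by
  obtain ⟨g, hg⟩ := VWords.exists_translation P e
  rcases hg t with h | ⟨t', ht', h⟩
  · exact Or.inl h
  · right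
    have h2 : (e : ell2 P →L[ℂ] ell2 P) (delta P t') = delta P t' := by
      have := congrArg (fun a : VWords P => (a : ell2 P →L[ℂ] ell2 P) (delta P t)) he
      simpa [h] using this
    rcases hg t' with h3 | ⟨t'', ht'', h3⟩
    · rw [h2] at h3; exact absurd h3 (delta_ne_zero P t')
    · have h4 : t' = t'' := delta_injective P (h2.symm.trans h3)
      rw [← h4] at ht''
      have hg1 : g = 1 := by simpa using ht''
      have : t' = t := Subtype.ext (by rw [ht', hg1, one_mul])
      rw [h, this]

theorem VWords.idempotent_comm {e f : VWords P} (he : IsIdempotentElem e)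
    (hf : IsIdempotentElem f) : e * f = f * e := by
  refine Subtype.ext (ext_delta P fun t => ?_)
  simp only [Submonoid.coe_mul, mul_apply_eq_comp]
  rcases VWords.idempotent_delta P he t with h | h <;>
    rcases VWords.idempotent_delta P hf t with h' | h' <;> simp [h, h']

/-- `I_V` is an inverse semigroup: every element `s` has a unique inverse, namely `star s`. -/
theorem VWords.inverse_iff (s t : VWords P) :
    (s * t * s = s ∧ t * s * t = t) ↔ t = star s := by
  have key : ∀ a b : VWords P, s * a * s = s → a * s * a = a → s * b * s = s → b * s * b = b →
      a = b := by
    intro a b ha ha' hb hb'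
    have e1 : IsIdempotentElem (s * a) := by
      change s * a * (s * a) = s * a; rw [← mul_assoc, ha]
    have e2 : IsIdempotentElem (s * b) := by
      change s * b * (s * b) = s * b; rw [← mul_assoc, hb]
    have e3 : IsIdempotentElem (a * s) := by
      change a * s * (a * s) = a * s; rw [← mul_assoc, ha']
    have e4 : IsIdempotentElem (b * s) := by
      change b * s * (b * s) = b * s; rw [← mul_assoc, hb']
    have h1 : a = a * s * b := by
      calc a = a * (s * a) := by rw [← mul_assoc, ha']
        _ = a * (s * b * s * a) := by rw [hb]
        _ = a * (s * b * (s * a)) := by simp only [mul_assoc]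
        _ = a * (s * a * (s * b)) := by rw [VWords.idempotent_comm P e2 e1]
        _ = a * s * a * (s * b) := by simp only [mul_assoc]
        _ = a * s * b := by rw [ha', mul_assoc]
    have h2 : b = a * s * b := by
      calc b = b * s * b := hb'.symm
        _ = b * (s * a * s) * b := by rw [ha]
        _ = b * s * (a * s) * b := by simp only [mul_assoc]
        _ = a * s * (b * s) * b := by rw [VWords.idempotent_comm P e4 e3]
        _ = a * s * (b * s * b) := by simp only [mul_assoc]
        _ = a * s * b := by rw [hb']
    exact h1.trans h2.symm
  have hs := VWords.mul_star_mul_self P s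
  have hs' : star s * s * star s = star s := by
    simpa using VWords.mul_star_mul_self P (star s)
  constructor
  · rintro ⟨h, h'⟩
    exact key t (star s) h h' hs hs'
  · rintro rfl
    exact ⟨hs, hs'⟩

/-- `V_p` as an element of `I_V`. -/
def VWords.V (p : P) : VWords P :=
  ⟨leftCreation P p, [(1, p)], by simp [starWord, leftCreation_one]⟩

/-- The generator `u_s` in the free `*`-algebra. -/
def genU (s : VWords P) : FreeStarAlg (VWords P) := FreeStarAlg.gen s

/-- The defining relations of the full C*-algebra of the inverse monoid `I_V`: a representation
of `I_V` by partial isometries is multiplicative, unital, preserves the involution (which is the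
inverse operation of `I_V`), and sends the zero operator to zero in case it is in `I_V`. -/
inductive VWordRel : FreeStarAlg (VWords P) → FreeStarAlg (VWords P) → Prop
  | partialIsometry (s : VWords P) : VWordRel (genU P s * star (genU P s) * genU P s) (genU P s)
  | one : VWordRel (genU P 1) 1
  | mul (s t : VWords P) : VWordRel (genU P (s * t)) (genU P s * genU P t)
  | star (s : VWords P) : VWordRel (genU P (star s)) (star (genU P s))
  | zero (s : VWords P) (hs : (s : ell2 P →L[ℂ] ell2 P) = 0) : VWordRel (genU P s) 0

/-- The presentation of the full C*-algebra of `I_V`. -/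
def vWordPresentation : CStarPresentation (VWords P) where
  rel := VWordRel P
  bounded s := by
    refine ⟨1, fun n hn => ?_⟩
    change n (genU P s) ≤ 1
    have h1 : n (star (genU P s) * genU P s * (star (genU P s) * genU P s)) =
        n (star (genU P s) * genU P s) := by
      apply n.eq_of_sub
      rw [mul_assoc, ← mul_assoc (genU P s), ← mul_sub]
      refine le_antisymm ((n.mul_le _ _).trans ?_) (n.nonneg _)
      rw [hn _ _ (VWordRel.partialIsometry s), mul_zero]
    have h2 := n.star_mul_self (star (genU P s) * genU P s)
    rw [star_mul, star_star, h1] at h2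
    have h3 := n.le_one_of_sq h2.symm
    rw [n.star_mul_self] at h3
    exact (sq_le_one_iff₀ (n.nonneg _)).1 h3

/-- The full C*-algebra `C*(I_V)`. -/
abbrev CStarI : Type _ := (vWordPresentation P).Alg

/-- The universal representation `u` of `I_V`. -/
def repI (s : VWords P) : CStarI P := (vWordPresentation P).of s

/-- The C*-subalgebra `C*(E)` of `C*(I_V)` generated by the semilattice `E` of idempotents. -/
def idempI : StarSubalgebra ℂ (CStarI P) :=
  (StarAlgebra.adjoin ℂ (repI P '' {s : VWords P | IsIdempotentElem s})).topologicalClosure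

end Semigroup

end

/-! Let `V_w` and `v_w` denote the words in the operators `V_p` and in the isometries `v_p` attached
to a list `w`. On `δ_t`, the operator `V_w` is translation by `g = groupWord P w` if `t` lies in the
ideal of the dual word, and zero otherwise (`starWord_leftCreation_delta`). So the operator `V_w`
determines this ideal and, when the ideal is nonempty, also `g`; conversely, if `g = 1` then `V_w`
is the projection onto the ideal's closed span and depends on the ideal alone.

The heart of the proof is that `V_w = V_{w'}` forces `v_w = v_{w'}` in `C*_s(P)`
(`starWord_isoS_congr`). If the operator is nonzero, both words have the same group element, so
relation (III) turns each of the four products in `(v_w - v_{w'})* (v_w - v_{w'})` into the same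
projection. They cancel, and the C*-identity gives the claim. If the operator is zero, then `v_w*
v_w = e_∅ = 0`. Hence `V_w ↦ v_w` is a well-defined representation of `I_V`, which yields `C*(I_V) →
C*_s(P)`.

In the other direction `v_p ↦ u(V_p)` and `e_x ↦ u(V_w V_w*)`, where `x` is the ideal of `w`. This
is independent of `w` and satisfies (III) because group-trivial V-words depend only on their ideals.
The two maps are inverse to each other on generators. Uniqueness holds because `e_x = v_w v_w*`
makes the `v_p` generate, and the diagonals correspond because every idempotent `s` of `I_V`
satisfies `s = s s*`. -/

section WordCalculus

/-! ### Words, their group elements and ideals, and their action on `ℓ²(P)` -/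

theorem dualWord_dualWord {P : Type*} (w : List (P × P)) : dualWord (dualWord w) = w := by
  simp [dualWord]

theorem dualWord_append {P : Type*} (w w' : List (P × P)) :
    dualWord (w ++ w') = dualWord w' ++ dualWord w := by
  simp [dualWord]

variable {G : Type*} [Group G] (P : Submonoid G)

theorem groupWord_append (w w' : List (P × P)) :
    groupWord P (w ++ w') = groupWord P w * groupWord P w' := by
  simp [groupWord]

theorem groupWord_dualWord (w : List (P × P)) : groupWord P (dualWord w) = (groupWord P w)⁻¹ := by
  induction w with
  | nil => simp [groupWord, dualWord]
  | cons x w ih =>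
    have h : dualWord (x :: w) = dualWord w ++ [x.swap] := by simp [dualWord]
    rw [h, groupWord_append, ih]
    simp [groupWord, mul_assoc]

theorem starAlgHom_starWord {P A B : Type*} [Ring A] [StarRing A] [Algebra ℂ A] [Ring B]
    [StarRing B] [Algebra ℂ B] (φ : A →⋆ₐ[ℂ] B) (a : P → A) (w : List (P × P)) :
    φ (starWord a w) = starWord (fun p => φ (a p)) w := by
  simp [starWord, map_list_prod, List.map_map, Function.comp_def, map_star]

theorem leftCreation_star_mul_self (p : P) : star (leftCreation P p) * leftCreation P p = 1 := by
  refine ContinuousLinearMap.ext fun f => ext_inner_left ℂ fun g => ?_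
  change inner ℂ g (star (leftCreation P p) (leftCreation P p f)) = inner ℂ g f
  rw [ContinuousLinearMap.star_eq_adjoint, ContinuousLinearMap.adjoint_inner_right]
  exact LinearIsometry.inner_map_map _ g f

theorem leftCreation_star_delta_mul (p s : P) :
    star (leftCreation P p) (delta P (p * s)) = delta P s := by
  rw [← leftCreation_delta]
  exact DFunLike.congr_fun (leftCreation_star_mul_self P p) (delta P s)

/-- A V-word translates `δ_t` for `t` in the constructible ideal of the dual word and kills it
otherwise. -/
theorem starWord_leftCreation_delta (w : List (P × P)) (t : P) :
    (t ∈ idealWord P (dualWord w) ∧ ∃ t' : P, (t' : G) = groupWord P w * t ∧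
        starWord (leftCreation P) w (delta P t) = delta P t') ∨
      (t ∉ idealWord P (dualWord w) ∧ starWord (leftCreation P) w (delta P t) = 0) := by
  -- The last letter of the word acts first on `δ_t`, and it becomes the head of the dual word,
  -- where `idealWord` unfolds.
  induction w using List.reverseRecOn generalizing t with
  | nil => exact Or.inl ⟨Set.mem_univ _, t, by simp [groupWord], by simp [starWord]⟩
  | append_singleton w x ih =>
    have hd : dualWord (w ++ [x]) = x.swap :: dualWord w := by simp [dualWord]
    have hm : t ∈ idealWord P (dualWord (w ++ [x])) ↔
        ∃ s ∈ idealWord P (dualWord w), x.1 * s = x.2 * t := by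
      rw [hd]; rfl
    have hs : starWord (leftCreation P) (w ++ [x]) (delta P t) =
        starWord (leftCreation P) w (star (leftCreation P x.1) (delta P (x.2 * t))) := by
      rw [starWord_append, ← leftCreation_delta]
      simp [starWord]
    rw [hm, hs]
    rcases leftCreation_star_delta P x.1 (x.2 * t) with h | ⟨s, hst, h⟩
    · refine Or.inr ⟨?_, by rw [h, map_zero]⟩
      rintro ⟨s, -, hst⟩
      rw [← hst, leftCreation_star_delta_mul] at h
      exact delta_ne_zero P s h
    · rw [h]
      rcases ih s with ⟨hsm, t', ht', h'⟩ | ⟨hsm, h'⟩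
      · refine Or.inl ⟨⟨s, hsm, hst⟩, t', ?_, h'⟩
        have h2 : (x.1 : G) * s = x.2 * t := congrArg (Subtype.val : P → G) hst
        rw [ht', groupWord_append]
        simp [groupWord, mul_assoc, ← h2]
      · refine Or.inr ⟨?_, h'⟩
        rintro ⟨r, hr, hrt⟩
        rw [← hst] at hrt
        exact hsm (mul_left_cancel hrt ▸ hr)

/-- Recovers the ideal from the operator, so that words with equal V-words have equal ideals. -/
theorem mem_idealWord_dualWord_iff (w : List (P × P)) (t : P) :
    t ∈ idealWord P (dualWord w) ↔ starWord (leftCreation P) w (delta P t) ≠ 0 := by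
  rcases starWord_leftCreation_delta P w t with ⟨h, t', -, h'⟩ | ⟨h, h'⟩
  · simp [h, h', delta_ne_zero P t']
  · simp [h, h']

/-- The V-word of a word that is trivial in the group is the projection onto its ideal. -/
theorem starWord_leftCreation_congr {w w' : List (P × P)} (hw : groupWord P w = 1)
    (hw' : groupWord P w' = 1)
    (h : idealWord P (dualWord w) = idealWord P (dualWord w')) :
    starWord (leftCreation P) w = starWord (leftCreation P) w' := by
  refine ext_delta P fun t => ?_
  rcases starWord_leftCreation_delta P w t with ⟨h1, s, hs, h2⟩ | ⟨h1, h2⟩ <;>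
    rcases starWord_leftCreation_delta P w' t with ⟨h3, s', hs', h4⟩ | ⟨h3, h4⟩
  · rw [h2, h4, Subtype.ext (hs.trans (by rw [hw, hs', hw']))]
  · exact absurd (h ▸ h1) h3
  · exact absurd (h ▸ h3) h1
  · rw [h2, h4]

/-- The product is `V_w* V_w`, and it kills the same basis vectors as `V_w` because `V_w V_w* V_w =
V_w`. -/
theorem idealWord_dualWord_star_mul {w w' : List (P × P)}
    (h : starWord (leftCreation P) w = starWord (leftCreation P) w') :
    idealWord P (dualWord (dualWord w ++ w')) = idealWord P (dualWord w) := by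
  ext t
  rw [mem_idealWord_dualWord_iff, mem_idealWord_dualWord_iff, starWord_append, ← star_starWord,
    ← h, not_iff_not, mul_apply_eq_comp]
  refine ⟨fun h0 => ?_, fun h0 => by rw [h0, map_zero]⟩
  have h1 := congrArg (fun a : VWords P => (a : ell2 P →L[ℂ] ell2 P) (delta P t))
    (VWords.mul_star_mul_self P ⟨starWord (leftCreation P) w, w, rfl⟩)
  simp only [Submonoid.coe_mul, VWords.coe_star, mul_apply_eq_comp] at h1
  rw [← h1, h0, map_zero]

/-- Realises the ideal of an arbitrary word by a word that is trivial in `G`, to which relation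
(III) applies. -/
theorem idealWord_dualWord_self_mul_star (w : List (P × P)) :
    idealWord P (dualWord (w ++ dualWord w)) = idealWord P w := by
  simpa [dualWord_dualWord] using
    idealWord_dualWord_star_mul P (w := dualWord w) (w' := dualWord w) rfl

theorem groupWord_append_dualWord_self (w : List (P × P)) :
    groupWord P (w ++ dualWord w) = 1 := by
  rw [groupWord_append, groupWord_dualWord, mul_inv_cancel]

/-- Both words move `δ_t` to the same basis vector, and `t` cancels in `G`. Some `t` in the ideal is
needed, since the zero operator carries no information on the group element. -/
theorem groupWord_eq_of_starWord_eq {w w' : List (P × P)}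
    (h : starWord (leftCreation P) w = starWord (leftCreation P) w') {t : P}
    (ht : t ∈ idealWord P (dualWord w)) : groupWord P w = groupWord P w' := by
  have hne := (mem_idealWord_dualWord_iff P w t).1 ht
  rcases starWord_leftCreation_delta P w t with ⟨-, s, hs, h2⟩ | ⟨-, h2⟩
  · rcases starWord_leftCreation_delta P w' t with ⟨-, s', hs', h4⟩ | ⟨-, h4⟩
    · have : s = s' := delta_injective P (by rw [← h2, h, h4])
      rw [← this, hs] at hs'
      exact mul_right_cancel hs'
    · exact absurd (h ▸ h4) hne
  · exact absurd h2 hne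

end WordCalculus

/-! ### Words in the isometries of `C*_s(P)` -/

section ConstructibleAlgebra

variable {G : Type*} [Group G] (P : Submonoid G)

theorem isoS_star_mul_self (p : P) : star (isoS P p) * isoS P p = 1 := by
  have h := (constrPresentation P).eval_of_rel (ConstrRel.isometry p)
  simp only [map_mul, map_star, map_one, genV, FreeStarAlg.eval_gen] at h
  exact h

theorem isoS_mul (p q : P) : isoS P (p * q) = isoS P p * isoS P q := by
  have h := (constrPresentation P).eval_of_rel (ConstrRel.mul p q)
  simp only [map_mul, genV, FreeStarAlg.eval_gen] at h
  exact h

/-- By (I) the isometry `v_1` is idempotent, and an idempotent isometry is the unit. -/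
theorem isoS_one : isoS P 1 = 1 := by
  have h := isoS_mul P 1 1
  rw [mul_one] at h
  have h2 := isoS_star_mul_self P 1
  calc isoS P 1 = star (isoS P 1) * isoS P 1 * isoS P 1 := by rw [h2, one_mul]
    _ = 1 := by rw [mul_assoc, ← h, h2]

theorem projS_empty : projS P ⟨∅, empty_mem P⟩ = 0 := by
  have h := (constrPresentation P).eval_of_rel (ConstrRel.empty (P := P))
  simp only [map_zero, genE, FreeStarAlg.eval_gen] at h
  exact h

theorem starWord_isoS (w : List (P × P)) (hw : groupWord P w = 1) :
    starWord (isoS P) w = projS P ⟨idealWord P (dualWord w), idealWord_mem P _⟩ := by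
  have h := (constrPresentation P).eval_of_rel (ConstrRel.word w hw)
  rw [starAlgHom_starWord] at h
  simp only [genV, genE, FreeStarAlg.eval_gen] at h
  exact h

theorem projS_congr {x y : constructibleIdeals P} (h : (x : Set P) = y) :
    projS P x = projS P y := congrArg _ (Subtype.ext h)

/-- Expresses the projections through the isometries, so that the `v_p` alone generate `C*_s(P)`. -/
theorem projS_eq_starWord (w : List (P × P)) :
    projS P ⟨idealWord P w, idealWord_mem P w⟩ = starWord (isoS P) (w ++ dualWord w) := by
  rw [starWord_isoS P _ (groupWord_append_dualWord_self P w)]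
  exact projS_congr P (idealWord_dualWord_self_mul_star P w).symm

/-- Equality of the group elements makes `dualWord w ++ w'` trivial in `G`, so (III) applies;
equality of the V-words identifies the resulting ideal. -/
theorem star_starWord_isoS_mul {w w' : List (P × P)} (hg : groupWord P w = groupWord P w')
    (h : starWord (leftCreation P) w = starWord (leftCreation P) w') :
    star (starWord (isoS P) w) * starWord (isoS P) w' =
      projS P ⟨idealWord P (dualWord w), idealWord_mem P _⟩ := by
  rw [star_starWord, ← starWord_append, starWord_isoS]
  · exact projS_congr P (idealWord_dualWord_star_mul P h)
  · rw [groupWord_append, groupWord_dualWord, hg, inv_mul_cancel]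

/-- Here `v_w* v_w = e_∅ = 0`, and the C*-identity gives `v_w = 0`. -/
theorem starWord_isoS_eq_zero {w : List (P × P)} (h : starWord (leftCreation P) w = 0) :
    starWord (isoS P) w = 0 := by
  have he : idealWord P (dualWord w) = ∅ := by
    ext t
    simp [mem_idealWord_dualWord_iff, h]
  rw [← CStarRing.star_mul_self_eq_zero_iff, star_starWord_isoS_mul P rfl rfl, ← projS_empty P]
  exact projS_congr P he

/-- The words in the isometries `v_p` depend only on the corresponding V-words. -/
theorem starWord_isoS_congr {w w' : List (P × P)}
    (h : starWord (leftCreation P) w = starWord (leftCreation P) w') :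
    starWord (isoS P) w = starWord (isoS P) w' := by
  -- An empty ideal means a zero V-word, for which the group elements of `w` and `w'` may differ;
  -- this case is settled separately.
  rcases (idealWord P (dualWord w)).eq_empty_or_nonempty with he | ⟨t, ht⟩
  · have h0 : starWord (leftCreation P) w = 0 := ext_delta P fun t => by
      by_contra hne
      have := (mem_idealWord_dualWord_iff P w t).2 hne
      simp [he] at this
    rw [starWord_isoS_eq_zero P h0, starWord_isoS_eq_zero P (h ▸ h0)]
  · have hg := groupWord_eq_of_starWord_eq P h ht
    have hd : idealWord P (dualWord w') = idealWord P (dualWord w) := by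
      ext t
      rw [mem_idealWord_dualWord_iff, mem_idealWord_dualWord_iff, h]
    have e := projS_congr P (x := ⟨_, idealWord_mem P _⟩) (y := ⟨_, idealWord_mem P _⟩) hd
    -- All four terms of `(v_w - v_{w'})* (v_w - v_{w'})` equal the same projection.
    rw [← sub_eq_zero, ← CStarRing.star_mul_self_eq_zero_iff, star_sub, mul_sub, sub_mul, sub_mul,
      star_starWord_isoS_mul P rfl rfl, star_starWord_isoS_mul P hg h,
      star_starWord_isoS_mul P hg.symm h.symm, star_starWord_isoS_mul P rfl rfl, e]
    simp

/-- The identity holds for V-words and is carried over by `starWord_isoS_congr`. -/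
theorem starWord_isoS_partialIsometry (w : List (P × P)) :
    starWord (isoS P) w * star (starWord (isoS P) w) * starWord (isoS P) w =
      starWord (isoS P) w := by
  rw [star_starWord, ← starWord_append, ← starWord_append]
  refine starWord_isoS_congr P ?_
  rw [starWord_append, starWord_append, ← star_starWord]
  exact congrArg Subtype.val
    (VWords.mul_star_mul_self P ⟨starWord (leftCreation P) w, w, rfl⟩)

end ConstructibleAlgebra

/-! ### The universal representation of `I_V` and the relations on both sides -/

section InverseSemigroupAlgebra

variable {G : Type*} [Group G] (P : Submonoid G)

/-- The element of `I_V` given by a word. -/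
noncomputable def VWords.ofWord (w : List (P × P)) : VWords P := ⟨starWord (leftCreation P) w, w, rfl⟩

theorem VWords.exists_ofWord (s : VWords P) : ∃ w, VWords.ofWord P w = s := by
  obtain ⟨_, w, rfl⟩ := s
  exact ⟨w, rfl⟩

/-- A word that represents a given element of `I_V`. -/
noncomputable def VWords.word (s : VWords P) : List (P × P) := (VWords.exists_ofWord P s).choose

theorem VWords.ofWord_word (s : VWords P) : VWords.ofWord P (VWords.word P s) = s :=
  (VWords.exists_ofWord P s).choose_spec

theorem VWords.starWord_word (s : VWords P) :
    starWord (leftCreation P) (VWords.word P s) = s :=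
  congrArg Subtype.val (VWords.ofWord_word P s)

theorem VWords.ofWord_append (w w' : List (P × P)) :
    VWords.ofWord P (w ++ w') = VWords.ofWord P w * VWords.ofWord P w' :=
  Subtype.ext (starWord_append _ _ _)

theorem VWords.ofWord_dualWord (w : List (P × P)) :
    VWords.ofWord P (dualWord w) = star (VWords.ofWord P w) :=
  Subtype.ext (star_starWord _ _).symm

theorem VWords.V_mul (p q : P) : VWords.V P (p * q) = VWords.V P p * VWords.V P q :=
  Subtype.ext (ext_delta P fun t => by
    simp [VWords.V, leftCreation_delta, mul_assoc])

theorem VWords.star_V_mul_self (p : P) : star (VWords.V P p) * VWords.V P p = 1 :=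
  Subtype.ext (leftCreation_star_mul_self P p)

theorem repI_one : repI P 1 = 1 := by
  have h := (vWordPresentation P).eval_of_rel (VWordRel.one (P := P))
  simp only [map_one, genU, FreeStarAlg.eval_gen] at h
  exact h

theorem repI_mul (s t : VWords P) : repI P (s * t) = repI P s * repI P t := by
  have h := (vWordPresentation P).eval_of_rel (VWordRel.mul s t)
  simp only [map_mul, genU, FreeStarAlg.eval_gen] at h
  exact h

theorem repI_star (s : VWords P) : repI P (star s) = star (repI P s) := by
  have h := (vWordPresentation P).eval_of_rel (VWordRel.star s)
  simp only [map_star, genU, FreeStarAlg.eval_gen] at h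
  exact h

theorem repI_zero (s : VWords P) (hs : (s : ell2 P →L[ℂ] ell2 P) = 0) : repI P s = 0 := by
  have h := (vWordPresentation P).eval_of_rel (VWordRel.zero s hs)
  simp only [map_zero, genU, FreeStarAlg.eval_gen] at h
  exact h

theorem starWord_repI (w : List (P × P)) :
    starWord (fun p => repI P (VWords.V P p)) w = repI P (VWords.ofWord P w) := by
  induction w with
  | nil => exact (repI_one P).symm
  | cons x w ih =>
    have h : VWords.ofWord P (x :: w) =
        star (VWords.V P x.1) * VWords.V P x.2 * VWords.ofWord P w := rfl
    rw [h, repI_mul, repI_mul, repI_star, ← ih]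
    rfl

open scoped Classical in
/-- The image in `C*(I_V)` of the projection of a constructible ideal. -/
noncomputable def projI (x : constructibleIdeals P) : CStarI P :=
  -- The default value 0 is taken only when `x` is empty and is not the ideal of any word.
  if h : ∃ w, idealWord P w = x then
    repI P (VWords.ofWord P (h.choose ++ dualWord h.choose)) else 0

/-- The chosen word does not matter: `w ++ dualWord w` is trivial in `G`, so its V-word depends only
on its ideal, which is that of `w`. -/
theorem projI_idealWord (w : List (P × P)) :
    projI P ⟨idealWord P w, idealWord_mem P w⟩ =
      repI P (VWords.ofWord P (w ++ dualWord w)) := by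
  have h : ∃ w', idealWord P w' = idealWord P w := ⟨w, rfl⟩
  rw [projI, dif_pos h]
  refine congrArg _ (Subtype.ext (starWord_leftCreation_congr P
    (groupWord_append_dualWord_self P _) (groupWord_append_dualWord_self P _) ?_))
  rw [idealWord_dualWord_self_mul_star, idealWord_dualWord_self_mul_star, h.choose_spec]

/-- This is relation (III) in `C*(I_V)`: two group-trivial words with the same ideal have the same
V-word. -/
theorem projI_of_groupWord (w : List (P × P)) (hw : groupWord P w = 1) :
    projI P ⟨idealWord P (dualWord w), idealWord_mem P _⟩ = repI P (VWords.ofWord P w) := by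
  rw [projI_idealWord]
  refine congrArg _ (Subtype.ext (starWord_leftCreation_congr P
    (groupWord_append_dualWord_self P _) hw ?_))
  rw [idealWord_dualWord_self_mul_star]

theorem VWords.ofWord_append_dualWord_self (w : List (P × P)) :
    IsIdempotentElem (VWords.ofWord P (w ++ dualWord w)) := by
  rw [VWords.ofWord_append, VWords.ofWord_dualWord, IsIdempotentElem, ← mul_assoc,
    VWords.mul_star_mul_self]

theorem projI_eq_zero_or (x : constructibleIdeals P) :
    projI P x = 0 ∨ ∃ s, IsIdempotentElem s ∧ star s = s ∧ projI P x = repI P s := by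
  by_cases h : ∃ w, idealWord P w = x
  · refine Or.inr ⟨_, VWords.ofWord_append_dualWord_self P h.choose, ?_, dif_pos h⟩
    rw [← VWords.ofWord_dualWord, dualWord_append, dualWord_dualWord]
  · exact Or.inl (dif_neg h)

/-- If some word has empty ideal, then `0` belongs to `I_V` and `u(0) = 0` applies; otherwise the
default value is already zero. -/
theorem projI_empty : projI P ⟨∅, empty_mem P⟩ = 0 := by
  by_cases h : ∃ w, idealWord P w = ∅
  · obtain ⟨w, hw⟩ := h
    have e : (⟨∅, empty_mem P⟩ : constructibleIdeals P) = ⟨idealWord P w, idealWord_mem P w⟩ :=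
      Subtype.ext hw.symm
    rw [e, projI_idealWord]
    refine repI_zero P _ (ext_delta P fun t => ?_)
    by_contra hne
    have := (mem_idealWord_dualWord_iff P (w ++ dualWord w) t).2 hne
    rw [idealWord_dualWord_self_mul_star, hw] at this
    exact this
  · exact dif_neg h

theorem constrRel_repI (a b : FreeStarAlg (ConstrGen P)) (h : ConstrRel P a b) :
    FreeStarAlg.eval (Sum.elim (fun p => repI P (VWords.V P p)) (projI P)) a =
      FreeStarAlg.eval (Sum.elim (fun p => repI P (VWords.V P p)) (projI P)) b := by
  cases h with
  | isometry p =>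
    simp only [map_mul, map_star, map_one, genV, FreeStarAlg.eval_gen, Sum.elim_inl]
    rw [← repI_star, ← repI_mul, VWords.star_V_mul_self, repI_one]
  | selfAdjoint x =>
    simp only [map_star, genE, FreeStarAlg.eval_gen, Sum.elim_inr]
    rcases projI_eq_zero_or P x with h | ⟨s, -, hs, h⟩
    · rw [h, star_zero]
    · rw [h, ← repI_star, hs]
  | idempotent x =>
    simp only [map_mul, genE, FreeStarAlg.eval_gen, Sum.elim_inr]
    rcases projI_eq_zero_or P x with h | ⟨s, hs, -, h⟩
    · rw [h, mul_zero]
    · rw [h, ← repI_mul, hs]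
  | mul p q =>
    simp only [map_mul, genV, FreeStarAlg.eval_gen, Sum.elim_inl]
    rw [VWords.V_mul, repI_mul]
  | empty =>
    simp only [map_zero, genE, FreeStarAlg.eval_gen, Sum.elim_inr]
    exact projI_empty P
  | word w hw =>
    rw [starAlgHom_starWord]
    simp only [genV, genE, FreeStarAlg.eval_gen, Sum.elim_inl, Sum.elim_inr]
    rw [starWord_repI, projI_of_groupWord P w hw]

/-- The assignment depends on a choice of words and is not visibly multiplicative. Each relation
compares words with equal V-words, so `starWord_isoS_congr` and its companions for partial
isometries and zero suffice. -/
theorem vWordRel_isoS (a b : FreeStarAlg (VWords P)) (h : VWordRel P a b) :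
    FreeStarAlg.eval (fun s => starWord (isoS P) (VWords.word P s)) a =
      FreeStarAlg.eval (fun s => starWord (isoS P) (VWords.word P s)) b := by
  cases h with
  | partialIsometry s =>
    simp only [map_mul, map_star, genU, FreeStarAlg.eval_gen]
    exact starWord_isoS_partialIsometry P _
  | one =>
    simp only [map_one, genU, FreeStarAlg.eval_gen]
    exact starWord_isoS_congr P (w' := []) (VWords.starWord_word P 1)
  | mul s t =>
    simp only [map_mul, genU, FreeStarAlg.eval_gen]
    rw [← starWord_append]
    refine starWord_isoS_congr P ?_
    rw [starWord_append]
    simp only [VWords.starWord_word, Submonoid.coe_mul]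
  | star s =>
    simp only [map_star, genU, FreeStarAlg.eval_gen]
    rw [star_starWord]
    refine starWord_isoS_congr P ?_
    rw [← star_starWord]
    simp only [VWords.starWord_word, VWords.coe_star]
  | zero s hs =>
    simp only [map_zero, genU, FreeStarAlg.eval_gen]
    exact starWord_isoS_eq_zero P ((VWords.starWord_word P s).trans hs)

/-! ### The mutually inverse homomorphisms, uniqueness and the diagonal -/

/-- The canonical homomorphism `C*_s(P) → C*(I_V)`. -/
noncomputable def constrToInverse : CStarS P →⋆ₐ[ℂ] CStarI P :=
  ((constrPresentation P).existsUnique_lift _ (constrRel_repI P)).choose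

theorem constrToInverse_isoS (p : P) :
    constrToInverse P (isoS P p) = repI P (VWords.V P p) :=
  ((constrPresentation P).existsUnique_lift _ (constrRel_repI P)).choose_spec.1 (Sum.inl p)

theorem constrToInverse_projS (x : constructibleIdeals P) :
    constrToInverse P (projS P x) = projI P x :=
  ((constrPresentation P).existsUnique_lift _ (constrRel_repI P)).choose_spec.1 (Sum.inr x)

theorem constrToInverse_starWord (w : List (P × P)) :
    constrToInverse P (starWord (isoS P) w) = repI P (VWords.ofWord P w) := by
  rw [starAlgHom_starWord]
  simp only [constrToInverse_isoS]
  exact starWord_repI P w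

/-- The canonical homomorphism `C*(I_V) → C*_s(P)`. -/
noncomputable def inverseToConstr : CStarI P →⋆ₐ[ℂ] CStarS P :=
  ((vWordPresentation P).existsUnique_lift _ (vWordRel_isoS P)).choose

theorem inverseToConstr_ofWord (w : List (P × P)) :
    inverseToConstr P (repI P (VWords.ofWord P w)) = starWord (isoS P) w :=
  (((vWordPresentation P).existsUnique_lift _ (vWordRel_isoS P)).choose_spec.1 _).trans
    (starWord_isoS_congr P (VWords.starWord_word P _))

/-- The images of the generators under `ψ` satisfy the relations, so the uniqueness part of the
universal property applies to both maps. -/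
theorem CStarPresentation.alg_hom_ext {X : Type*} (𝓟 : CStarPresentation X) {B : Type*}
    [CStarAlgebra B] {φ ψ : 𝓟.Alg →⋆ₐ[ℂ] B} (h : ∀ x, φ (𝓟.of x) = ψ (𝓟.of x)) : φ = ψ := by
  have he : FreeStarAlg.eval (fun x => ψ (𝓟.of x)) = ψ.comp 𝓟.polyHom :=
    FreeStarAlg.hom_ext fun x => by rw [FreeStarAlg.eval_gen]; rfl
  refine (𝓟.existsUnique_lift (fun x => ψ (𝓟.of x)) fun a b hab => ?_).unique h fun _ => rfl
  rw [he, 𝓟.polyHom_eq_eval]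
  exact congrArg ψ (𝓟.eval_of_rel hab)

/-- A homomorphism on `C*_s(P)` is determined by its values on the isometries `v_p`. -/
theorem CStarS.hom_ext {B : Type*} [CStarAlgebra B] {φ ψ : CStarS P →⋆ₐ[ℂ] B}
    (h : ∀ p, φ (isoS P p) = ψ (isoS P p)) : φ = ψ := by
  refine (constrPresentation P).alg_hom_ext ?_
  rintro (p | ⟨x, rfl | ⟨w, rfl⟩⟩)
  · exact h p
  · change φ (projS P ⟨∅, _⟩) = ψ (projS P ⟨∅, _⟩)
    rw [projS_empty, map_zero, map_zero]
  · change φ (projS P ⟨idealWord P w, _⟩) = ψ (projS P ⟨idealWord P w, _⟩)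
    rw [projS_eq_starWord, starAlgHom_starWord, starAlgHom_starWord]
    simp only [h]

theorem inverseToConstr_comp : (inverseToConstr P).comp (constrToInverse P) =
    StarAlgHom.id ℂ (CStarS P) := by
  refine CStarS.hom_ext P fun p => ?_
  -- Since `V_1 = 1`, the operator `V_p` is the one-letter word `V_1* V_p`.
  have h : VWords.V P p = VWords.ofWord P [(1, p)] :=
    Subtype.ext (by simp [VWords.V, VWords.ofWord, starWord, leftCreation_one])
  rw [StarAlgHom.comp_apply, constrToInverse_isoS, h, inverseToConstr_ofWord]
  simp [starWord, isoS_one]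

theorem constrToInverse_comp : (constrToInverse P).comp (inverseToConstr P) =
    StarAlgHom.id ℂ (CStarI P) := by
  refine (vWordPresentation P).alg_hom_ext fun s => ?_
  change constrToInverse P (inverseToConstr P (repI P s)) = repI P s
  rw [← VWords.ofWord_word P s, inverseToConstr_ofWord, constrToInverse_starWord]

/-- The canonical isomorphism `C*_s(P) ≃ C*(I_V)`. -/
noncomputable def constrEquivInverse : CStarS P ≃⋆ₐ[ℂ] CStarI P :=
  StarAlgEquiv.ofStarAlgHom (constrToInverse P) (inverseToConstr P)
    (inverseToConstr_comp P) (constrToInverse_comp P)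

/-- A `*`-homomorphism is contractive, so the preimage of a closed subalgebra is closed and it
suffices to check generators. -/
theorem StarAlgHom.map_adjoin_closure_le {A B : Type*} [CStarAlgebra A] [CStarAlgebra B]
    (φ : A →⋆ₐ[ℂ] B) {s : Set A} {t : Set B}
    (h : ∀ a ∈ s, φ a ∈ (StarAlgebra.adjoin ℂ t).topologicalClosure) :
    (StarAlgebra.adjoin ℂ s).topologicalClosure ≤
      (StarAlgebra.adjoin ℂ t).topologicalClosure.comap φ := by
  have hφ : Continuous φ := AddMonoidHomClass.continuous_of_bound φ 1 fun a => by
    rw [one_mul]; exact NonUnitalStarAlgHom.norm_apply_le φ a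
  refine StarSubalgebra.topologicalClosure_minimal (StarAlgebra.adjoin_le h) ?_
  exact (StarSubalgebra.isClosed_topologicalClosure _).preimage hφ

theorem diagS_map_constrToInverse : (diagS P).map (constrToInverse P) = idempI P := by
  apply le_antisymm
  · rw [StarSubalgebra.map_le_iff_le_comap]
    refine StarAlgHom.map_adjoin_closure_le _ ?_
    rintro _ ⟨x, rfl⟩
    rw [constrToInverse_projS]
    rcases projI_eq_zero_or P x with h | ⟨s, hs, -, h⟩
    · rw [h]; exact zero_mem _
    · rw [h]
      exact StarSubalgebra.le_topologicalClosure _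
        (StarAlgebra.subset_adjoin ℂ _ ⟨s, hs, rfl⟩)
  -- Pulling back along the inverse map avoids proving that the image of `D_s(P)` is closed.
  · have key : idempI P ≤ (diagS P).comap (inverseToConstr P) := by
      refine StarAlgHom.map_adjoin_closure_le _ ?_
      rintro _ ⟨s, hs, rfl⟩
      -- An idempotent is an inverse of itself, hence self-adjoint by uniqueness of inverses. Then
      -- `s = s s*` is given by a word `w ++ dualWord w`, which is sent to a projection `e_x`.
      have h1 : star s = s := ((VWords.inverse_iff P s s).1
        ⟨by rw [hs, hs], by rw [hs, hs]⟩).symm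
      obtain ⟨w, rfl⟩ := VWords.exists_ofWord P s
      have h2 : VWords.ofWord P (w ++ dualWord w) = VWords.ofWord P w := by
        rw [VWords.ofWord_append, VWords.ofWord_dualWord, h1, hs]
      rw [← h2, inverseToConstr_ofWord, ← projS_eq_starWord]
      exact StarSubalgebra.le_topologicalClosure _ (StarAlgebra.subset_adjoin ℂ _ ⟨_, rfl⟩)
    intro b hb
    exact ⟨inverseToConstr P b, key hb, DFunLike.congr_fun (constrToInverse_comp P) b⟩

end InverseSemigroupAlgebra

theorem theorem3p1 {G : Type*} [Group G] (P : Submonoid G) :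
    ∃ Φ : CStarS P ≃⋆ₐ[ℂ] CStarI P,
      (∀ p : P, Φ (isoS P p) = repI P (VWords.V P p)) ∧
      (diagS P).map (Φ : CStarS P →⋆ₐ[ℂ] CStarI P) = idempI P ∧
      ∀ Ψ : CStarS P →⋆ₐ[ℂ] CStarI P,
        (∀ p : P, Ψ (isoS P p) = repI P (VWords.V P p)) → Ψ = (Φ : CStarS P →⋆ₐ[ℂ] CStarI P) := by
  have hΦ : ((constrEquivInverse P : CStarS P ≃⋆ₐ[ℂ] CStarI P) : CStarS P →⋆ₐ[ℂ] CStarI P) =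
      constrToInverse P := rfl
  refine ⟨constrEquivInverse P, constrToInverse_isoS P, ?_, fun Ψ hΨ => ?_⟩
  · rw [hΦ]
    exact diagS_map_constrToInverse P
  · rw [hΦ]
    exact CStarS.hom_ext P fun p => (hΨ p).trans (constrToInverse_isoS P p).symm
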